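/- **Anonymous bandits.** There are $N$ users, $K$ arms, $T$ rounds and a minimum group size $C\ge 1$. An instance consists of a probability distribution $\mathcal D_{i,j}$ on $\mathbb R$ for every user $i\in[N]$ and arm $j\in[K]$ that is $1$-subgaussian (that is, $\mathbb E[e^{s(X-\mathbb E X)}]\le e^{s^2/2}$ for $X\sim\mathcal D_{i,j}$ and all $s\in\mathbb R$) and has mean $\mu_{i,j}\in[0,1]$. In every round $t$ the learner assigns each user $i$ to an arm $\pi_t(i)$, and user $i$ receives a reward $r_{i,t}$ drawn from $\mathcal D_{i,\pi_t(i)}$, independently over users and rounds. In the same round the learner chooses pairwise disjoint groups of users, each of size at least $C$ and each consisting of users assigned to the same arm; it observes only the total reward $\sum_{i\in G}r_{i,t}$ of each chosen group $G$. A learning algorithm may know $N,K,C,U,T$ and may be randomized; its decisions in round $t$ depend only on its internal randomness and on its decisions and observations in earlier rounds. Its expected regret on an instance is $$\mathbf{Reg}=T\sum_{i=1}^N\max_j\mu_{i,j}-\mathbb E\Big[\sum_{t=1}^T\sum_{i=1}^N r_{i,t}\Big].$$ An instance satisfies the user-cluster assumption with parameter $U$ if every arm $j$ is the (unique) optimal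 arm of at least $U$ users, i.e. $\mu_{i,j}>\mu_{i,j'}$ for all $j'\ne j$ for at least $U$ users $i$. **Theorem.** There is an absolute constant $c>0$ such that for all integers $K\ge 2$, $C\ge 1$, $U\ge K(C+1)$, $N\ge 2KU$ and $T\ge CK$ the following hold. 1. For every learning algorithm there is an instance satisfying the user-cluster assumption with parameter $U$ on which its expected regret is at least $c\,N\sqrt{CKT}$. 2. Moreover, there is a single probability distribution (uniform on a finite list) over instances satisfying the user-cluster assumption with parameter $U$, not depending on the algorithm, such that for every learning algorithm the expected regret, averaged over an instance drawn from this distribution, is at least $c\,N\sqrt{CKT}$. -/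

import Mathlib

open MeasureTheory ProbabilityTheory

universe u

namespace AnonymousBandits

/-- A problem instance with `N` users and `K` arms: for every user `i` and arm `j` a reward
distribution `D i j` on `ℝ` that is `1`-subgaussian (after centering) with mean in `[0, 1]`. -/
structure Instance (N K : ℕ) where
  D : Fin N → Fin K → Measure ℝ
  isProb : ∀ i j, IsProbabilityMeasure (D i j)
  subgaussian : ∀ i j, HasSubgaussianMGF (fun x : ℝ => x - ∫ y, y ∂(D i j)) 1 (D i j)
  mean_mem : ∀ i j, (∫ y, y ∂(D i j)) ∈ Set.Icc (0 : ℝ) 1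

/-- The mean reward of user `i` on arm `j`. -/
noncomputable def Instance.mean {N K : ℕ} (I : Instance N K) (i : Fin N) (j : Fin K) : ℝ :=
  ∫ y, y ∂(I.D i j)

/-- Arm `j` is the (unique) optimal arm of user `i`. -/
def Instance.IsOptimalArm {N K : ℕ} (I : Instance N K) (i : Fin N) (j : Fin K) : Prop :=
  ∀ j', j' ≠ j → I.mean i j' < I.mean i j

/-- The user-cluster assumption with parameter `U`: every arm is the optimal arm of at least `U`
users. -/
def Instance.UserCluster {N K : ℕ} (I : Instance N K) (U : ℕ) : Prop :=
  ∀ j : Fin K, U ≤ Set.ncard {i : Fin N | I.IsOptimalArm i j}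

/-- What the learner decides in one round: an arm for every user, and a partition of a subset of
the users into groups of size at least `C`, all members of a group playing the same arm. -/
structure Action (N K C : ℕ) where
  assign : Fin N → Fin K
  groups : Finset (Finset (Fin N))
  card_group : ∀ G ∈ groups, C ≤ G.card
  disjoint_groups : ∀ G ∈ groups, ∀ H ∈ groups, G ≠ H → Disjoint G H
  same_arm : ∀ G ∈ groups, ∀ i ∈ G, ∀ i' ∈ G, assign i = assign i'

/-- There are finitely many actions; every set of actions is measurable. -/
instance (N K C : ℕ) : MeasurableSpace (Action N K C) := ⊤

/-- The feedback of one round: one number for every group (and `0` at every set of users that is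
not one of the groups chosen in this round). -/
abbrev Feedback (N : ℕ) : Type := Finset (Fin N) → ℝ

/-- The feedback for the action `a` when `r i j` is the reward of user `i` on arm `j` in this
round: the total reward of every group. -/
def Action.observe {N K C : ℕ} (a : Action N K C) (r : Fin N → Fin K → ℝ) : Feedback N :=
  fun G => if G ∈ a.groups then ∑ i ∈ G, r i (a.assign i) else 0

/-- A (possibly randomized) learning algorithm for `T` rounds. Its internal randomness is a seed
drawn from an arbitrary probability space, independently of the rewards; in round `t` it chooses an
action as a function of the seed and of the feedback received in the earlier rounds. (The earlier
actions are themselves functions of the seed and of the earlier feedback.) -/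
structure Algorithm (N K C T : ℕ) where
  Seed : Type u
  seedSpace : MeasurableSpace Seed
  seedLaw : Measure Seed
  isProb : IsProbabilityMeasure seedLaw
  act : (t : Fin T) → Seed → (Fin t → Feedback N) → Action N K C
  measurable_act : ∀ t : Fin T, Measurable fun p : Seed × (Fin t → Feedback N) => act t p.1 p.2

attribute [instance] Instance.isProb Algorithm.seedSpace Algorithm.isProb

/-- The feedback received in the rounds before round `t`, when `r s i j` is the reward of user `i`
on arm `j` in round `s`. -/
def Algorithm.history {N K C T : ℕ} (A : Algorithm.{u} N K C T) (ω : A.Seed)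
    (r : Fin T → Fin N → Fin K → ℝ) : (t : ℕ) → t ≤ T → Fin t → Feedback N
  | 0, _ => Fin.elim0
  | t + 1, h =>
    Fin.snoc (α := fun _ => Feedback N) (A.history ω r t (Nat.le_of_succ_le h))
      ((A.act ⟨t, h⟩ ω (A.history ω r t (Nat.le_of_succ_le h))).observe (r ⟨t, h⟩))

/-- The action chosen in round `t`. -/
def Algorithm.action {N K C T : ℕ} (A : Algorithm.{u} N K C T) (ω : A.Seed)
    (r : Fin T → Fin N → Fin K → ℝ) (t : Fin T) : Action N K C :=
  A.act t ω (A.history ω r t t.isLt.le)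

/-- The total reward of all users over all rounds. -/
def Algorithm.totalReward {N K C T : ℕ} (A : Algorithm.{u} N K C T) (ω : A.Seed)
    (r : Fin T → Fin N → Fin K → ℝ) : ℝ :=
  ∑ t : Fin T, ∑ i : Fin N, r t i ((A.action ω r t).assign i)

/-- The law of the rewards over `T` rounds: all independent, that of user `i` on arm `j` in any
round with law `D i j`. -/
noncomputable def Instance.rewardLaw {N K : ℕ} (I : Instance N K) (T : ℕ) :
    Measure (Fin T → Fin N → Fin K → ℝ) :=
  Measure.pi fun _ => Measure.pi fun i => Measure.pi fun j => I.D i j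

/-- The expected regret of the algorithm `A` on the instance `I` (the total reward is integrable,
as its absolute value is at most the sum of all `|r t i j|`). -/
noncomputable def Algorithm.expectedRegret {N K C T : ℕ} (A : Algorithm.{u} N K C T)
    (I : Instance N K) : ℝ :=
  (T : ℝ) * ∑ i : Fin N, (⨆ j : Fin K, I.mean i j)
    - ∫ p, A.totalReward p.1 p.2 ∂(A.seedLaw.prod (I.rewardLaw T))

end AnonymousBandits

/-!
The hard distribution has Gaussian rewards of variance `1`. User `i` has mean `ε` on one best arm
and `0` on all others, with `ε = √(C K / T) / 8`. The best arms of the first `K * U ≤ N / 2` users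
are fixed so as to guarantee the cluster property, and those of all other users are hidden: they are
independent and uniform.

For a user `i` with a hidden arm, compare the instance in which this arm is `j` with the instance in
which all means of `i` are `0`. They differ only in the mean of user `i` on arm `j`, and the learner
sees this only through the sum of the group containing `i`, which has at least `C` members. Raising
the mean of `i` by `ε` changes this sum in the same way as raising the means of all members of the
group `G` by `ε / |G|`, and this shift has squared length `ε ^ 2 / |G| ≤ ε ^ 2 / C`
(`exists_shift_of_action`). Hence a round in which `i` plays `j` reveals at most `ε ^ 2 / (2 C)` of
divergence, and the other rounds reveal nothing. Because the shift depends on the action of the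
round, the change of measure is carried out round by round (`Algorithm.lintegral_history_eq`), with
the log-likelihood ratio written explicitly as a function of the rewards. Its expectation is at
least `-ε ^ 2 / (2 C)` times the expected number of plays of `j` by `i` when all means of `i` are
`0` (`Algorithm.neg_integral_pathLogLR_le`).

These numbers of plays add up to `T` over the `K` arms, so on average over `j` the divergence is at
most `ε ^ 2 T / (2 C K)`, a small constant. So on average user `i` plays its hidden arm in at most a
constant fraction of the rounds (`Algorithm.sum_pullProb_spike_le`), and its expected regret is of
order `ε T`, which is of order `√(C K T)`. There are at least `N / 2` such users. The seed of the
algorithm is fixed throughout this argument and integrated out at the end.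
-/

namespace AnonymousBandits

/-! ### Product measures -/

/-- A product of probability measures with densities has the product density. -/
lemma pi_withDensity_eq {ι : Type*} [Fintype ι] {α : ι → Type*} [∀ i, MeasurableSpace (α i)]
    (μ : ∀ i, Measure (α i)) [∀ i, IsProbabilityMeasure (μ i)] (f : ∀ i, α i → ENNReal)
    (hf : ∀ i, Measurable (f i)) [∀ i, SigmaFinite ((μ i).withDensity (f i))] :
    Measure.pi (fun i => (μ i).withDensity (f i)) =
      (Measure.pi μ).withDensity (fun x => ∏ i, f i (x i)) := by
  refine Measure.pi_eq fun s hs => ?_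
  rw [withDensity_apply _ (MeasurableSet.univ_pi hs),
    ← lintegral_indicator (MeasurableSet.univ_pi hs)]
  have hprod : ∀ x : ∀ i, α i, (Set.univ.pi s).indicator (fun x => ∏ i, f i (x i)) x
      = ∏ i, (s i).indicator (f i) (x i) := by
    intro x
    by_cases hx : x ∈ Set.univ.pi s
    · rw [Set.indicator_of_mem hx]
      exact Finset.prod_congr rfl fun i _ => (Set.indicator_of_mem (hx i (Set.mem_univ i)) _).symm
    · rw [Set.indicator_of_notMem hx]
      simp only [Set.mem_pi, Set.mem_univ, true_imp_iff, not_forall] at hx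
      obtain ⟨i, hi⟩ := hx
      exact (Finset.prod_eq_zero (Finset.mem_univ i) (Set.indicator_of_notMem hi _)).symm
  have hm : ∀ i, Measurable ((s i).indicator (f i)) := fun i => (hf i).indicator (hs i)
  simp_rw [hprod]
  rw [lintegral_prod_eq_prod_lintegral_of_indepFun Finset.univ
    (fun i (x : ∀ i, α i) => (s i).indicator (f i) (x i))
    (iIndepFun_pi fun i => (hm i).aemeasurable) fun i => (hm i).comp (measurable_pi_apply i)]
  refine Finset.prod_congr rfl fun i _ => ?_
  rw [(measurePreserving_eval μ i).lintegral_comp (hm i), lintegral_indicator (hs i),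
    withDensity_apply _ (hs i)]

/-- Resampling one coordinate of a product measure does not change the law. -/
lemma measurePreserving_update_pi {ι : Type*} [Fintype ι] [DecidableEq ι] {α : ι → Type*}
    [∀ i, MeasurableSpace (α i)] (μ : ∀ i, Measure (α i)) [∀ i, IsProbabilityMeasure (μ i)]
    (i : ι) :
    MeasurePreserving (fun p : (∀ k, α k) × α i => Function.update p.1 i p.2)
      ((Measure.pi μ).prod (μ i)) (Measure.pi μ) := by
  have hmeas : Measurable fun p : (∀ k, α k) × α i => Function.update p.1 i p.2 := by
    refine measurable_pi_lambda _ fun k => ?_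
    by_cases h : k = i
    · subst h; simpa using measurable_snd
    · simpa [h, Function.comp_def] using (measurable_pi_apply k).comp measurable_fst
  refine ⟨hmeas, (Measure.pi_eq fun s hs => ?_).symm⟩
  rw [Measure.map_apply hmeas (MeasurableSet.univ_pi hs)]
  have hpre : (fun p : (∀ k, α k) × α i => Function.update p.1 i p.2) ⁻¹' (Set.univ.pi s)
      = (Set.univ.pi (Function.update s i Set.univ)) ×ˢ s i := by
    ext p
    simp only [Set.mem_preimage, Set.mem_pi, Set.mem_univ, true_imp_iff, Set.mem_prod]
    constructor
    · intro h
      refine ⟨fun k => ?_, by simpa using h i⟩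
      by_cases hk : k = i
      · subst hk; simp
      · simpa [hk] using h k
    · rintro ⟨h, hi⟩ k
      by_cases hk : k = i
      · subst hk; simpa using hi
      · simpa [hk] using h k
  rw [hpre, Measure.prod_prod, Measure.pi_pi, ← Finset.prod_erase_mul _ _ (Finset.mem_univ i),
    ← Finset.prod_erase_mul Finset.univ (fun k => μ k (s k)) (Finset.mem_univ i)]
  simp only [Function.update_self, measure_univ, mul_one]
  congr 1
  refine Finset.prod_congr rfl fun k hk => ?_
  rw [Function.update_of_ne (Finset.ne_of_mem_erase hk)]

lemma lintegral_pi_eq_lintegral_update {ι : Type*} [Fintype ι] [DecidableEq ι] {α : ι → Type*}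
    [∀ i, MeasurableSpace (α i)] (μ : ∀ i, Measure (α i)) [∀ i, IsProbabilityMeasure (μ i)]
    (i : ι) {f : (∀ k, α k) → ENNReal} (hf : Measurable f) :
    ∫⁻ x, f x ∂(Measure.pi μ) = ∫⁻ x, ∫⁻ y, f (Function.update x i y) ∂(μ i) ∂(Measure.pi μ) := by
  have h := measurePreserving_update_pi μ i
  rw [← h.lintegral_comp hf,
    lintegral_prod (fun p : (∀ k, α k) × α i => f (Function.update p.1 i p.2))
      (hf.comp h.measurable).aemeasurable]

lemma integral_pi_eq_integral_update {ι : Type*} [Fintype ι] [DecidableEq ι] {α : ι → Type*}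
    [∀ i, MeasurableSpace (α i)] (μ : ∀ i, Measure (α i)) [∀ i, IsProbabilityMeasure (μ i)]
    (i : ι) {f : (∀ k, α k) → ℝ} (hf : Integrable f (Measure.pi μ)) :
    ∫ x, f x ∂(Measure.pi μ) = ∫ x, ∫ y, f (Function.update x i y) ∂(μ i) ∂(Measure.pi μ) := by
  have h := measurePreserving_update_pi μ i
  have h1 := integral_map (μ := (Measure.pi μ).prod (μ i)) h.measurable.aemeasurable (f := f)
    (by rw [h.map_eq]; exact hf.aestronglyMeasurable)
  rw [h.map_eq] at h1
  rw [h1, integral_prod]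
  exact (h.integrable_comp hf.aestronglyMeasurable).2 hf

/-! ### Gaussian rewards -/

/-- The law of the rewards of one round when that of user `i` on arm `j` is normal with mean
`M i j` and variance `1`, all independent. -/
noncomputable def roundLaw {N K : ℕ} (M : Fin N → Fin K → ℝ) : Measure (Fin N → Fin K → ℝ) :=
  Measure.pi fun i => Measure.pi fun j => gaussianReal (M i j) 1

instance {N K : ℕ} (M : Fin N → Fin K → ℝ) : IsProbabilityMeasure (roundLaw M) := by
  unfold roundLaw; infer_instance

/-- The log-likelihood ratio of a shift by `v` of a Gaussian vector with mean `M` and identity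
covariance. -/
noncomputable def logLR {N K : ℕ} (M v x : Fin N → Fin K → ℝ) : ℝ :=
  ∑ k, ∑ l, (v k l * (x k l - M k l) - v k l ^ 2 / 2)

lemma gaussianReal_add_eq_withDensity (m δ : ℝ) :
    gaussianReal (m + δ) 1 = (gaussianReal m 1).withDensity
      (fun x => ENNReal.ofReal (Real.exp (δ * (x - m) - δ ^ 2 / 2))) := by
  rw [gaussianReal_of_var_ne_zero _ one_ne_zero, gaussianReal_of_var_ne_zero _ one_ne_zero,
    ← withDensity_mul _ (measurable_gaussianPDF _ _) (by fun_prop)]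
  congr 1
  ext x
  simp only [gaussianPDF, Pi.mul_apply]
  rw [← ENNReal.ofReal_mul (gaussianPDFReal_nonneg _ _ _)]
  simp only [gaussianPDFReal]
  rw [mul_assoc _ (Real.exp _), ← Real.exp_add]
  congr 3
  push_cast
  ring

lemma roundLaw_add_eq_withDensity {N K : ℕ} (M v : Fin N → Fin K → ℝ) :
    roundLaw (M + v) = (roundLaw M).withDensity
      (fun x => ENNReal.ofReal (Real.exp (logLR M v x))) := by
  let f : Fin N → Fin K → ℝ → ENNReal := fun i j x =>
    ENNReal.ofReal (Real.exp (v i j * (x - M i j) - v i j ^ 2 / 2))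
  have hf : ∀ i j, Measurable (f i j) := fun i j => by fun_prop
  have h1 : ∀ i j, gaussianReal ((M + v) i j) 1 = (gaussianReal (M i j) 1).withDensity (f i j) :=
    fun i j => gaussianReal_add_eq_withDensity _ _
  have i1 : ∀ i j, IsProbabilityMeasure ((gaussianReal (M i j) 1).withDensity (f i j)) :=
    fun i j => by rw [← h1]; infer_instance
  have h2 : ∀ i, Measure.pi (fun j => gaussianReal ((M + v) i j) 1) =
      (Measure.pi fun j => gaussianReal (M i j) 1).withDensity (fun x => ∏ j, f i j (x j)) := by
    intro i
    simp_rw [h1]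
    exact pi_withDensity_eq _ _ (hf i)
  have i2 : ∀ i, IsProbabilityMeasure
      ((Measure.pi fun j => gaussianReal (M i j) 1).withDensity (fun x => ∏ j, f i j (x j))) :=
    fun i => by rw [← h2]; infer_instance
  unfold roundLaw
  simp_rw [h2]
  rw [pi_withDensity_eq _ _ fun i => by fun_prop]
  congr 1
  ext x
  simp only [f, logLR, Real.exp_sum]
  rw [ENNReal.ofReal_prod_of_nonneg fun i _ => by positivity]
  refine Finset.prod_congr rfl fun i _ => ?_
  rw [ENNReal.ofReal_prod_of_nonneg fun i _ => by positivity]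

lemma map_add_roundLaw {N K : ℕ} (M v : Fin N → Fin K → ℝ) :
    (roundLaw M).map (fun x => x + v) = roundLaw (M + v) := by
  unfold roundLaw
  have h1 : ∀ i, (Measure.pi fun j => gaussianReal (M i j) 1).map (fun x j => x j + v i j)
      = Measure.pi fun j => gaussianReal ((M + v) i j) 1 := by
    intro i
    have i0 : ∀ j, SigmaFinite ((gaussianReal (M i j) 1).map (fun x => x + v i j)) := fun j => by
      rw [gaussianReal_map_add_const]; infer_instance
    rw [Measure.pi_map_pi (f := fun j x => x + v i j) fun j => by fun_prop]
    simp_rw [gaussianReal_map_add_const]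
    rfl
  have i1 : ∀ i, SigmaFinite
      ((Measure.pi fun j => gaussianReal (M i j) 1).map (fun x j => x j + v i j)) := fun i => by
    rw [h1]; infer_instance
  have h2 := Measure.pi_map_pi (μ := fun i => Measure.pi fun j => gaussianReal (M i j) 1)
    (f := fun i x j => x j + v i j) fun i =>
      (measurable_pi_lambda _ fun j => (measurable_pi_apply j).add_const _).aemeasurable
  simp_rw [h1] at h2
  exact h2

/-! ### Feedback of one round -/

instance {N K C : ℕ} : Finite (Action N K C) := by
  refine Finite.of_injective (fun a : Action N K C => (a.assign, a.groups)) ?_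
  rintro ⟨a, b, _, _, _⟩ ⟨a', b', _, _, _⟩ h
  simpa using h

instance {N K C : ℕ} : DiscreteMeasurableSpace (Action N K C) := ⟨fun _ => trivial⟩

lemma Action.measurable_observe {N K C : ℕ} (a : Action N K C) : Measurable a.observe := by
  refine measurable_pi_lambda _ fun G => ?_
  unfold Action.observe
  by_cases h : G ∈ a.groups
  · simp only [h, if_true]; fun_prop
  · simp only [h, if_false]; fun_prop

/-- The matrix with the single nonzero entry `ε` at user `i` and arm `j`. -/
def spike {N K : ℕ} (i : Fin N) (j : Fin K) (ε : ℝ) : Fin N → Fin K → ℝ :=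
  fun k l => if k = i ∧ l = j then ε else 0

/-- For a fixed action, raising the mean of user `i` on arm `j` by `ε` has the same effect on the
feedback as spreading this amount evenly over the group of `i`. Since that group has at least `C`
members, the latter shift has squared length at most `ε ^ 2 / C`. -/
lemma exists_shift_of_action {N K C : ℕ} (hC : 1 ≤ C) (a : Action N K C) (i : Fin N) (j : Fin K)
    (ε : ℝ) : ∃ v : Fin N → Fin K → ℝ,
      (∀ x, a.observe (x + v) = a.observe (x + spike i j ε)) ∧
      ∑ k, ∑ l, v k l ^ 2 ≤ if a.assign i = j then ε ^ 2 / C else 0 := by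
  have hCpos : (0 : ℝ) < C := by exact_mod_cast hC
  have key : ∀ v : Fin N → Fin K → ℝ,
      (∀ G ∈ a.groups, ∑ k ∈ G, v k (a.assign k) = ∑ k ∈ G, spike i j ε k (a.assign k)) →
      ∀ x, a.observe (x + v) = a.observe (x + spike i j ε) := by
    intro v hv x
    ext G
    unfold Action.observe
    split_ifs with hG
    · simp only [Pi.add_apply, Finset.sum_add_distrib, hv G hG]
    · rfl
  by_cases h : a.assign i = j ∧ ∃ G ∈ a.groups, i ∈ G
  · obtain ⟨hj, G, hG, hiG⟩ := h
    have hcard : (C : ℝ) ≤ G.card := by exact_mod_cast a.card_group G hG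
    have hcpos : (0 : ℝ) < G.card := hCpos.trans_le hcard
    refine ⟨fun k l => if k ∈ G ∧ l = j then ε / G.card else 0, key _ fun H hH => ?_, ?_⟩
    · by_cases hHG : H = G
      · subst hHG
        have h1 : ∀ k ∈ H, (if k ∈ H ∧ a.assign k = j then ε / (H.card : ℝ) else 0)
            = ε / H.card := fun k hk => by
          rw [if_pos ⟨hk, (a.same_arm H hH k hk i hiG).trans hj⟩]
        have h2 : ∑ k ∈ H, spike i j ε k (a.assign k) = ε := by
          rw [Finset.sum_eq_single_of_mem i hiG fun b _ hb => by simp [spike, hb]]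
          simp [spike, hj]
        rw [h2, Finset.sum_congr rfl h1, Finset.sum_const, nsmul_eq_mul]
        field_simp
      · have hd := a.disjoint_groups H hH G hG hHG
        rw [Finset.sum_eq_zero, Finset.sum_eq_zero]
        · intro k hk
          rw [spike, if_neg]
          rintro ⟨rfl, -⟩
          exact Finset.disjoint_left.1 hd hk hiG
        · intro k hk
          rw [if_neg]
          rintro ⟨hk', -⟩
          exact Finset.disjoint_left.1 hd hk hk'
    · have h2 : ∀ k, ∑ l, (if k ∈ G ∧ l = j then ε / (G.card : ℝ) else 0) ^ 2
          = if k ∈ G then (ε / (G.card : ℝ)) ^ 2 else 0 := by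
        intro k
        by_cases hk : k ∈ G <;> simp [hk, ite_pow]
      simp only [h2, hj, if_true, Finset.sum_ite_mem, Finset.univ_inter, Finset.sum_const,
        nsmul_eq_mul]
      calc (G.card : ℝ) * (ε / G.card) ^ 2 = ε ^ 2 / G.card := by field_simp
        _ ≤ ε ^ 2 / C := by gcongr
  · refine ⟨0, key _ fun H hH => ?_, ?_⟩
    · simp only [Pi.zero_apply, Finset.sum_const_zero]
      refine (Finset.sum_eq_zero fun k hk => ?_).symm
      rw [spike, if_neg]
      rintro ⟨rfl, hj⟩
      exact h ⟨hj, H, hH, hk⟩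
    · simp only [Pi.zero_apply, ne_eq, OfNat.ofNat_ne_zero, not_false_eq_true, zero_pow,
        Finset.sum_const_zero]
      split_ifs <;> positivity

lemma measurable_logLR {N K : ℕ} (M v : Fin N → Fin K → ℝ) : Measurable (logLR M v) := by
  unfold logLR; fun_prop

/-- One round of the change of measure: a shift `v` that an action cannot distinguish from `w`
yields a likelihood ratio for the feedback under the shift `w`. -/
lemma lintegral_observe_roundLaw_add {N K C : ℕ} (a : Action N K C) {v w : Fin N → Fin K → ℝ}
    (h : ∀ x, a.observe (x + v) = a.observe (x + w)) (M : Fin N → Fin K → ℝ)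
    {g : Feedback N → ENNReal} (hg : Measurable g) :
    ∫⁻ x, g (a.observe x) ∂(roundLaw (M + w)) =
      ∫⁻ x, ENNReal.ofReal (Real.exp (logLR M v x)) * g (a.observe x) ∂(roundLaw M) := by
  have ho := hg.comp a.measurable_observe
  have hadd : ∀ u : Fin N → Fin K → ℝ, ∫⁻ x, g (a.observe x) ∂(roundLaw (M + u))
      = ∫⁻ x, g (a.observe (x + u)) ∂(roundLaw M) := by
    intro u
    rw [← map_add_roundLaw]
    exact lintegral_map ho (by fun_prop)
  rw [hadd w, ← lintegral_congr fun x => congrArg g (h x), ← hadd v, roundLaw_add_eq_withDensity]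
  exact lintegral_withDensity_eq_lintegral_mul _ (measurable_logLR M v).exp.ennreal_ofReal ho

/-! ### The interaction over several rounds -/

lemma measurable_observe {N K C : ℕ} :
    Measurable fun p : Action N K C × (Fin N → Fin K → ℝ) => p.1.observe p.2 :=
  measurable_from_prod_countable_right fun a => a.measurable_observe

lemma measurable_snoc_feedback {N n : ℕ} :
    Measurable fun p : (Fin n → Feedback N) × Feedback N =>
      (Fin.snoc (α := fun _ => Feedback N) p.1 p.2 : Fin (n + 1) → Feedback N) := by
  refine measurable_pi_lambda _ fun k => ?_
  induction k using Fin.lastCases with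
  | last => simpa using measurable_snd
  | cast k => simpa [Function.comp_def] using (measurable_pi_apply k).comp measurable_fst

variable {N K C T : ℕ}

lemma Algorithm.measurable_history (A : Algorithm.{u} N K C T) : ∀ (n : ℕ) (h : n ≤ T),
    Measurable fun p : A.Seed × (Fin T → Fin N → Fin K → ℝ) => A.history p.1 p.2 n h
  | 0, _ => measurable_const
  | n + 1, h => by
    have ih := A.measurable_history n (Nat.le_of_succ_le h)
    have ha := (A.measurable_act ⟨n, h⟩).comp (measurable_fst.prodMk ih)
    have ho := measurable_observe.comp
      (ha.prodMk ((measurable_pi_apply (⟨n, h⟩ : Fin T)).comp measurable_snd))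
    exact measurable_snoc_feedback.comp (ih.prodMk ho)

lemma Algorithm.measurable_action (A : Algorithm.{u} N K C T) (t : Fin T) :
    Measurable fun p : A.Seed × (Fin T → Fin N → Fin K → ℝ) => A.action p.1 p.2 t :=
  (A.measurable_act t).comp (measurable_fst.prodMk (A.measurable_history t t.isLt.le))

lemma Algorithm.measurable_action_right (A : Algorithm.{u} N K C T) (ω : A.Seed) (t : Fin T) :
    Measurable fun r : Fin T → Fin N → Fin K → ℝ => A.action ω r t :=
  (A.measurable_action t).comp measurable_prodMk_left

/-- The history before round `n` does not depend on the rewards of later rounds. -/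
lemma Algorithm.history_update (A : Algorithm.{u} N K C T) (ω : A.Seed)
    (r : Fin T → Fin N → Fin K → ℝ) (t : Fin T) (x : Fin N → Fin K → ℝ) :
    ∀ (n : ℕ) (h : n ≤ T), n ≤ t → A.history ω (Function.update r t x) n h = A.history ω r n h
  | 0, _, _ => rfl
  | n + 1, h, hn => by
    have ih := A.history_update ω r t x n (Nat.le_of_succ_le h) (by omega)
    have hne : (⟨n, h⟩ : Fin T) ≠ t := fun e => by
      have := congrArg Fin.val e
      simp only at this
      omega
    simp only [Algorithm.history, ih, Function.update_of_ne hne]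

lemma Algorithm.action_update (A : Algorithm.{u} N K C T) (ω : A.Seed)
    (r : Fin T → Fin N → Fin K → ℝ) (t : Fin T) (x : Fin N → Fin K → ℝ) {s : Fin T} (h : s ≤ t) :
    A.action ω (Function.update r t x) s = A.action ω r s := by
  unfold Algorithm.action
  rw [A.history_update ω r t x s s.isLt.le h]

/-- The law of all rewards over `T` rounds when each round has law `roundLaw M`. -/
noncomputable def gaussLaw (T : ℕ) (M : Fin N → Fin K → ℝ) :
    Measure (Fin T → Fin N → Fin K → ℝ) :=
  Measure.pi fun _ => roundLaw M

instance (M : Fin N → Fin K → ℝ) : IsProbabilityMeasure (gaussLaw T M) := by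
  unfold gaussLaw; infer_instance

/-- The log-likelihood ratio accumulated in the first `n` rounds, when the mean of the rewards of
a round with action `a` is shifted by `V a`. -/
noncomputable def Algorithm.pathLogLR (A : Algorithm.{u} N K C T) (ω : A.Seed)
    (M : Fin N → Fin K → ℝ) (V : Action N K C → Fin N → Fin K → ℝ) (n : ℕ)
    (r : Fin T → Fin N → Fin K → ℝ) : ℝ :=
  ∑ s ∈ Finset.univ.filter (fun s : Fin T => (s : ℕ) < n), logLR M (V (A.action ω r s)) (r s)

lemma measurable_logLR_action (M : Fin N → Fin K → ℝ) (V : Action N K C → Fin N → Fin K → ℝ) :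
    Measurable fun p : Action N K C × (Fin N → Fin K → ℝ) => logLR M (V p.1) p.2 :=
  measurable_from_prod_countable_right fun a => measurable_logLR M (V a)

lemma Algorithm.measurable_pathLogLR (A : Algorithm.{u} N K C T) (ω : A.Seed)
    (M : Fin N → Fin K → ℝ) (V : Action N K C → Fin N → Fin K → ℝ) (n : ℕ) :
    Measurable (A.pathLogLR ω M V n) := by
  have h : ∀ s : Fin T, Measurable fun r : Fin T → Fin N → Fin K → ℝ =>
      logLR M (V (A.action ω r s)) (r s) := by
    intro s
    have hs : Measurable fun r : Fin T → Fin N → Fin K → ℝ => r s := measurable_pi_apply s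
    have hp : Measurable fun r : Fin T → Fin N → Fin K → ℝ => (A.action ω r s, r s) :=
      (A.measurable_action_right ω s).prodMk hs
    have hc := Measurable.comp (measurable_logLR_action M V) hp
    simpa only [Function.comp_def] using hc
  unfold Algorithm.pathLogLR
  exact Finset.measurable_sum (f := fun (s : Fin T) (r : Fin T → Fin N → Fin K → ℝ) =>
      logLR M (V (A.action ω r s)) (r s)) _ fun s _ => h s

/-- Change of measure for the adaptive interaction: if for every action `a` the shift by `V a` has
the same effect on the feedback as the shift by `w`, then the law of the history under mean `M + w`
has a density with respect to that under mean `M` given by the accumulated likelihood ratio. -/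
lemma Algorithm.lintegral_history_eq (A : Algorithm.{u} N K C T) (ω : A.Seed)
    (M w : Fin N → Fin K → ℝ) (V : Action N K C → Fin N → Fin K → ℝ)
    (hV : ∀ (a : Action N K C) x, a.observe (x + V a) = a.observe (x + w)) :
    ∀ (n : ℕ) (h : n ≤ T) (g : (Fin n → Feedback N) → ENNReal), Measurable g →
      ∫⁻ r, g (A.history ω r n h) ∂(gaussLaw T (M + w)) =
        ∫⁻ r, ENNReal.ofReal (Real.exp (A.pathLogLR ω M V n r)) * g (A.history ω r n h)
          ∂(gaussLaw T M)
  | 0, h, g, hg => by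
    simp [Algorithm.history, Algorithm.pathLogLR]
  | n + 1, h, g, hg => by
    have hn : n ≤ T := Nat.le_of_succ_le h
    have ih := A.lintegral_history_eq ω M w V hV n hn
    set t : Fin T := ⟨n, h⟩ with ht
    have hH : ∀ m hm, Measurable fun r => A.history ω r m hm := fun m hm =>
      (A.measurable_history m hm).comp measurable_prodMk_left
    -- the feedback of round `n` appended to the history `η`
    let next : (Fin n → Feedback N) → (Fin N → Fin K → ℝ) → Fin (n + 1) → Feedback N :=
      fun η x => Fin.snoc (α := fun _ => Feedback N) η ((A.act t ω η).observe x)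
    have hact : Measurable fun η : Fin n → Feedback N => A.act t ω η :=
      (A.measurable_act t).comp measurable_prodMk_left
    have hnext : Measurable fun p : (Fin n → Feedback N) × (Fin N → Fin K → ℝ) =>
        next p.1 p.2 :=
      measurable_snoc_feedback.comp (measurable_fst.prodMk
        (measurable_observe.comp ((hact.comp measurable_fst).prodMk measurable_snd)))
    have hup : ∀ r x, A.history ω (Function.update r t x) (n + 1) h
        = next (A.history ω r n hn) x := by
      intro r x
      simp only [Algorithm.history, next, A.history_update ω r t x n hn le_rfl]
      exact congrArg (fun y => Fin.snoc (α := fun _ => Feedback N) (A.history ω r n hn)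
        ((A.act t ω (A.history ω r n hn)).observe y)) (Function.update_self t x r)
    have hL : ∀ r x, A.pathLogLR ω M V (n + 1) (Function.update r t x)
        = logLR M (V (A.act t ω (A.history ω r n hn))) x + A.pathLogLR ω M V n r := by
      intro r x
      have hf : Finset.univ.filter (fun s : Fin T => (s : ℕ) < n + 1)
          = insert t (Finset.univ.filter (fun s : Fin T => (s : ℕ) < n)) := by
        ext s
        simp only [Finset.mem_filter, Finset.mem_univ, true_and, Finset.mem_insert, Fin.ext_iff, ht]
        omega
      unfold Algorithm.pathLogLR
      rw [hf, Finset.sum_insert (by simp [ht]), A.action_update ω r t x le_rfl,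
        Function.update_self]
      congr 1
      refine Finset.sum_congr rfl fun s hs => ?_
      have hs' : (s : ℕ) < n := (Finset.mem_filter.1 hs).2
      have hst : s ≤ t := Fin.le_def.2 hs'.le
      rw [A.action_update ω r t x hst, Function.update_of_ne]
      exact fun e => hs'.ne (congrArg Fin.val e)
    have hround : ∀ η, ∫⁻ x, g (next η x) ∂(roundLaw (M + w)) =
        ∫⁻ x, ENNReal.ofReal (Real.exp (logLR M (V (A.act t ω η)) x)) * g (next η x)
          ∂(roundLaw M) := fun η =>
      lintegral_observe_roundLaw_add (A.act t ω η) (hV _) M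
        (g := fun y => g (Fin.snoc (α := fun _ => Feedback N) η y))
        (hg.comp (measurable_snoc_feedback.comp measurable_prodMk_left))
    have hG : Measurable fun η => ∫⁻ x, g (next η x) ∂(roundLaw (M + w)) :=
      (hg.comp hnext).lintegral_prod_right'
    have hPm := (A.measurable_pathLogLR ω M V (n + 1)).exp.ennreal_ofReal.mul
      (hg.comp (hH (n + 1) h))
    have step1 := lintegral_pi_eq_lintegral_update (fun _ : Fin T => roundLaw (M + w)) t
      (hg.comp (hH (n + 1) h))
    have step2 := lintegral_pi_eq_lintegral_update (fun _ : Fin T => roundLaw M) t hPm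
    simp only [Function.comp_apply, Pi.mul_apply, hup, hL] at step1 step2
    unfold gaussLaw at ih ⊢
    rw [step1, step2, ih _ hG]
    refine lintegral_congr fun r => ?_
    rw [hround, ← lintegral_const_mul']
    · refine lintegral_congr fun x => ?_
      rw [Real.exp_add, ENNReal.ofReal_mul (Real.exp_nonneg _)]
      ring
    · exact ENNReal.ofReal_ne_top

/-! ### Divergence along the interaction -/

lemma measurePreserving_eval_roundLaw (M : Fin N → Fin K → ℝ) (k : Fin N) (l : Fin K) :
    MeasurePreserving (fun x : Fin N → Fin K → ℝ => x k l) (roundLaw M)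
      (gaussianReal (M k l) 1) :=
  (measurePreserving_eval (fun j => gaussianReal (M k j) 1) l).comp
    (measurePreserving_eval (fun i => Measure.pi fun j => gaussianReal (M i j) 1) k)

lemma integrable_eval_roundLaw (M : Fin N → Fin K → ℝ) (k : Fin N) (l : Fin K) :
    Integrable (fun x : Fin N → Fin K → ℝ => x k l) (roundLaw M) :=
  ((measurePreserving_eval_roundLaw M k l).integrable_comp aestronglyMeasurable_id).2
    ((memLp_id_gaussianReal 1).integrable le_rfl)

lemma integral_eval_roundLaw (M : Fin N → Fin K → ℝ) (k : Fin N) (l : Fin K) :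
    ∫ x, x k l ∂(roundLaw M) = M k l := by
  have h := measurePreserving_eval_roundLaw M k l
  have h1 := integral_map (μ := roundLaw M) h.measurable.aemeasurable (f := fun y : ℝ => y)
    aestronglyMeasurable_id
  rw [h.map_eq, integral_id_gaussianReal] at h1
  exact h1.symm

lemma integrable_logLR (M v : Fin N → Fin K → ℝ) : Integrable (logLR M v) (roundLaw M) := by
  unfold logLR
  refine integrable_finsetSum _ fun k _ => integrable_finsetSum _ fun l _ => ?_
  exact (((integrable_eval_roundLaw M k l).sub (integrable_const _)).const_mul _).sub
    (integrable_const _)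

lemma integral_logLR (M v : Fin N → Fin K → ℝ) :
    ∫ x, logLR M v x ∂(roundLaw M) = -(∑ k, ∑ l, v k l ^ 2) / 2 := by
  have h1 : ∀ k l, Integrable (fun x : Fin N → Fin K → ℝ => v k l * (x k l - M k l))
      (roundLaw M) := fun k l =>
    ((integrable_eval_roundLaw M k l).sub (integrable_const _)).const_mul _
  have h2 : ∀ k l, Integrable
      (fun x : Fin N → Fin K → ℝ => v k l * (x k l - M k l) - v k l ^ 2 / 2) (roundLaw M) :=
    fun k l => (h1 k l).sub (integrable_const _)
  unfold logLR
  rw [integral_finsetSum _ fun k _ => integrable_finsetSum _ fun l _ => h2 k l, neg_div,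
    Finset.sum_div, ← Finset.sum_neg_distrib]
  refine Finset.sum_congr rfl fun k _ => ?_
  rw [integral_finsetSum _ fun l _ => h2 k l, Finset.sum_div, ← Finset.sum_neg_distrib]
  refine Finset.sum_congr rfl fun l _ => ?_
  rw [integral_sub (h1 k l) (integrable_const _), integral_const_mul,
    integral_sub (integrable_eval_roundLaw M k l) (integrable_const _), integral_eval_roundLaw]
  simp

/-- Integrability of a function of an action and of a reward vector with law `roundLaw M`; it
holds because there are only finitely many actions. -/
lemma integrable_action_reward {Ω : Type*} [MeasurableSpace Ω] {P : Measure Ω}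
    {M : Fin N → Fin K → ℝ} {α : Ω → Action N K C} (hα : Measurable α)
    {ρ : Ω → Fin N → Fin K → ℝ} (hρ : MeasurePreserving ρ P (roundLaw M))
    {F : Action N K C → (Fin N → Fin K → ℝ) → ℝ} (hFm : ∀ a, Measurable (F a))
    (hF : ∀ a, Integrable (F a) (roundLaw M)) :
    Integrable (fun ω => F (α ω) (ρ ω)) P := by
  have := Fintype.ofFinite (Action N K C)
  have hm : Measurable fun p : Action N K C × (Fin N → Fin K → ℝ) => F p.1 p.2 :=
    measurable_from_prod_countable_right hFm
  have hb : Integrable (fun ω => ∑ a, |F a (ρ ω)|) P :=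
    integrable_finsetSum _ fun a _ =>
      ((hρ.integrable_comp (hF a).aestronglyMeasurable).2 (hF a)).abs
  have hmeas : Measurable fun ω => F (α ω) (ρ ω) := hm.comp (hα.prodMk hρ.measurable)
  refine hb.mono' hmeas.aestronglyMeasurable (Filter.Eventually.of_forall fun ω => ?_)
  exact Finset.single_le_sum (f := fun a => |F a (ρ ω)|) (fun a _ => abs_nonneg _)
    (Finset.mem_univ (α ω))

lemma measurePreserving_eval_gaussLaw (M : Fin N → Fin K → ℝ) (t : Fin T) :
    MeasurePreserving (fun r : Fin T → Fin N → Fin K → ℝ => r t) (gaussLaw T M) (roundLaw M) :=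
  measurePreserving_eval (fun _ : Fin T => roundLaw M) t

/-- The rewards of round `t` are independent of the action of round `t`. -/
lemma Algorithm.integral_action_reward (A : Algorithm.{u} N K C T) (ω : A.Seed)
    (M : Fin N → Fin K → ℝ) (t : Fin T) {F : Action N K C → (Fin N → Fin K → ℝ) → ℝ}
    (hFm : ∀ a, Measurable (F a)) (hF : ∀ a, Integrable (F a) (roundLaw M)) :
    ∫ r, F (A.action ω r t) (r t) ∂(gaussLaw T M) =
      ∫ r, ∫ x, F (A.action ω r t) x ∂(roundLaw M) ∂(gaussLaw T M) := by
  have hi := integrable_action_reward (A.measurable_action_right ω t)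
    (measurePreserving_eval_gaussLaw M t) hFm hF
  have h := integral_pi_eq_integral_update (fun _ : Fin T => roundLaw M) t hi
  simp only [A.action_update ω _ t _ le_rfl, Function.update_self] at h
  exact h

/-- The probability that arm `j` is assigned to user `i` in round `t`, for a given seed and
Gaussian rewards with means `M`. -/
noncomputable def Algorithm.pullProb (A : Algorithm.{u} N K C T) (ω : A.Seed)
    (M : Fin N → Fin K → ℝ) (i : Fin N) (j : Fin K) (t : Fin T) : ℝ :=
  ∫ r, (if (A.action ω r t).assign i = j then 1 else 0) ∂(gaussLaw T M)

lemma Algorithm.measurable_pull (A : Algorithm.{u} N K C T) (i : Fin N) (j : Fin K) (t : Fin T) :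
    Measurable fun p : A.Seed × (Fin T → Fin N → Fin K → ℝ) =>
      if (A.action p.1 p.2 t).assign i = j then (1 : ℝ) else 0 :=
  (Measurable.of_discrete (f := fun a : Action N K C =>
    if a.assign i = j then (1 : ℝ) else 0)).comp (A.measurable_action t)

lemma Algorithm.integrable_pull (A : Algorithm.{u} N K C T) (ω : A.Seed)
    (M : Fin N → Fin K → ℝ) (i : Fin N) (j : Fin K) (t : Fin T) :
    Integrable (fun r => if (A.action ω r t).assign i = j then (1 : ℝ) else 0) (gaussLaw T M) := by
  refine Integrable.of_bound (((A.measurable_pull i j t).comp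
    measurable_prodMk_left).aestronglyMeasurable) 1 (Filter.Eventually.of_forall fun r => ?_)
  split_ifs <;> simp

lemma Algorithm.pullProb_nonneg (A : Algorithm.{u} N K C T) (ω : A.Seed)
    (M : Fin N → Fin K → ℝ) (i : Fin N) (j : Fin K) (t : Fin T) : 0 ≤ A.pullProb ω M i j t :=
  integral_nonneg fun r => by dsimp only; split_ifs <;> simp

lemma Algorithm.pullProb_le_one (A : Algorithm.{u} N K C T) (ω : A.Seed)
    (M : Fin N → Fin K → ℝ) (i : Fin N) (j : Fin K) (t : Fin T) : A.pullProb ω M i j t ≤ 1 := by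
  have h := integral_mono (A.integrable_pull ω M i j t) (integrable_const (1 : ℝ))
    fun r => by dsimp only; split_ifs <;> simp
  simpa [Algorithm.pullProb] using h

lemma Algorithm.sum_pullProb (A : Algorithm.{u} N K C T) (ω : A.Seed)
    (M : Fin N → Fin K → ℝ) (i : Fin N) (t : Fin T) : ∑ j, A.pullProb ω M i j t = 1 := by
  unfold Algorithm.pullProb
  rw [← integral_finsetSum _ fun j _ => A.integrable_pull ω M i j t]
  simp

lemma Algorithm.integrable_pathLogLR (A : Algorithm.{u} N K C T) (ω : A.Seed)
    (M : Fin N → Fin K → ℝ) (V : Action N K C → Fin N → Fin K → ℝ) (n : ℕ) :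
    Integrable (A.pathLogLR ω M V n) (gaussLaw T M) := by
  unfold Algorithm.pathLogLR
  exact integrable_finsetSum _ fun s _ => integrable_action_reward (A.measurable_action_right ω s)
    (measurePreserving_eval_gaussLaw M s) (fun a => measurable_logLR M (V a))
    fun a => integrable_logLR M (V a)

/-- Chain rule: the divergence `-𝔼 [log L]` accumulated in the first `n` rounds is at most
`ε ^ 2 / (2 * C)` times the expected number of rounds in which user `i` plays arm `j`, because each
round contributes half the expected squared length of the shift. -/
lemma Algorithm.neg_integral_pathLogLR_le (A : Algorithm.{u} N K C T) (ω : A.Seed)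
    (M : Fin N → Fin K → ℝ) (V : Action N K C → Fin N → Fin K → ℝ) (i : Fin N) (j : Fin K) (ε : ℝ)
    (hV : ∀ a, ∑ k, ∑ l, V a k l ^ 2 ≤ if a.assign i = j then ε ^ 2 / C else 0) (n : ℕ) :
    -∫ r, A.pathLogLR ω M V n r ∂(gaussLaw T M) ≤
      ε ^ 2 / (2 * C) * ∑ s, A.pullProb ω M i j s := by
  have hround : ∀ s : Fin T, -∫ r, logLR M (V (A.action ω r s)) (r s) ∂(gaussLaw T M) ≤
      ε ^ 2 / (2 * C) * A.pullProb ω M i j s := by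
    intro s
    rw [A.integral_action_reward ω M s (F := fun a x => logLR M (V a) x)
      (fun a => measurable_logLR M (V a)) fun a => integrable_logLR M (V a)]
    simp only [integral_logLR]
    rw [← integral_neg, Algorithm.pullProb, ← integral_const_mul]
    refine integral_mono_of_nonneg (Filter.Eventually.of_forall fun r => ?_)
      ((A.integrable_pull ω M i j s).const_mul _) (Filter.Eventually.of_forall fun r => ?_)
    · simp only [Pi.zero_apply, neg_div, neg_neg]
      positivity
    · have := hV (A.action ω r s)
      dsimp only
      split_ifs at this ⊢ with h
      · rw [neg_div, neg_neg, mul_one, mul_comm (2 : ℝ), ← div_div]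
        linarith
      · linarith
  unfold Algorithm.pathLogLR
  rw [integral_finsetSum _ fun s _ => integrable_action_reward (A.measurable_action_right ω s)
    (measurePreserving_eval_gaussLaw M s) (fun a => measurable_logLR M (V a))
    fun a => integrable_logLR M (V a), ← Finset.sum_neg_distrib, Finset.mul_sum]
  refine (Finset.sum_le_sum fun s _ => hround s).trans ?_
  exact Finset.sum_le_sum_of_subset_of_nonneg (Finset.subset_univ _) fun s _ _ =>
    mul_nonneg (by positivity) (A.pullProb_nonneg ω M i j s)

/-- A pointwise substitute for Pinsker's inequality, with `exp y` in the role of the likelihood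
ratio: for a likelihood ratio `L` of mean `1` it gives `𝔼 |L - 1| ≤ 𝔼 [-log L] / c + c`. -/
lemma abs_exp_sub_one_le (y : ℝ) {c : ℝ} (hc : 0 < c) :
    |Real.exp y - 1| ≤ (Real.exp y - 1 - y) / c + c / 2 * (Real.exp y + 1) := by
  set s := Real.exp (y / 2) with hs
  have hspos : 0 < s := Real.exp_pos _
  have hsq : Real.exp y = s ^ 2 := by rw [hs, ← Real.exp_nat_mul]; congr 1; push_cast; ring
  have hlin : y / 2 + 1 ≤ s := Real.add_one_le_exp _
  have h1 : (s - 1) ^ 2 ≤ s ^ 2 - 1 - y := by nlinarith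
  have h2 : |s ^ 2 - 1| = |s - 1| * (s + 1) := by
    rw [show s ^ 2 - 1 = (s - 1) * (s + 1) by ring, abs_mul, abs_of_pos (by linarith : 0 < s + 1)]
  rw [hsq, h2]
  have h3 : |s - 1| * (s + 1) ≤ (s - 1) ^ 2 / c + c / 4 * (s + 1) ^ 2 := by
    have h := sq_nonneg (|s - 1| - c / 2 * (s + 1))
    rw [div_add' _ _ _ hc.ne', le_div_iff₀ hc]
    nlinarith [sq_abs (s - 1)]
  have h4 : (s - 1) ^ 2 / c ≤ (s ^ 2 - 1 - y) / c := by gcongr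
  have h5 : (s + 1) ^ 2 ≤ 2 * (s ^ 2 + 1) := by nlinarith [sq_nonneg (s - 1)]
  nlinarith

/-- Raising the mean of user `i` on arm `j` by `ε` increases the probability that this arm is played
in round `t` by little, unless the arm is played often already without the raise. -/
lemma Algorithm.pullProb_add_spike_le (A : Algorithm.{u} N K C T) (hC : 1 ≤ C) (ω : A.Seed)
    (M : Fin N → Fin K → ℝ) (i : Fin N) (j : Fin K) (ε : ℝ) {c : ℝ} (hc : 0 < c) (t : Fin T) :
    A.pullProb ω (M + spike i j ε) i j t ≤ A.pullProb ω M i j t + c +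
      ε ^ 2 / (2 * C) * (∑ s, A.pullProb ω M i j s) / c := by
  choose V hobs hV using fun a : Action N K C => exists_shift_of_action hC a i j ε
  set ℓ := A.pathLogLR ω M V t with hℓ
  have hℓm : Measurable ℓ := A.measurable_pathLogLR ω M V t
  have hcm := A.lintegral_history_eq ω M (spike i j ε) V hobs t t.isLt.le
  have hmass : ∫⁻ r, ENNReal.ofReal (Real.exp (ℓ r)) ∂(gaussLaw T M) = 1 := by
    simpa using (hcm (fun _ => 1) measurable_const).symm
  have hexp : Integrable (fun r => Real.exp (ℓ r)) (gaussLaw T M) := by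
    refine ⟨hℓm.exp.aestronglyMeasurable, ?_⟩
    rw [hasFiniteIntegral_iff_ofReal (Filter.Eventually.of_forall fun r => (Real.exp_pos _).le),
      hmass]
    exact ENNReal.one_lt_top
  have hexp1 : ∫ r, Real.exp (ℓ r) ∂(gaussLaw T M) = 1 := by
    rw [integral_eq_lintegral_of_nonneg_ae
      (Filter.Eventually.of_forall fun r => (Real.exp_pos _).le) hℓm.exp.aestronglyMeasurable,
      hmass, ENNReal.toReal_one]
  let ind : (Fin T → Fin N → Fin K → ℝ) → ℝ :=
    fun r => if (A.action ω r t).assign i = j then 1 else 0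
  have hind0 : ∀ r, 0 ≤ ind r := fun r => by simp only [ind]; split_ifs <;> simp
  have hind1 : ∀ r, ind r ≤ 1 := fun r => by simp only [ind]; split_ifs <;> simp
  have hindm : Measurable ind := (A.measurable_pull i j t).comp measurable_prodMk_left
  have hprod : Integrable (fun r => Real.exp (ℓ r) * ind r) (gaussLaw T M) := by
    refine hexp.mono' (hℓm.exp.mul hindm).aestronglyMeasurable
      (Filter.Eventually.of_forall fun r => ?_)
    rw [Real.norm_eq_abs, abs_of_nonneg (mul_nonneg (Real.exp_pos _).le (hind0 r))]
    exact mul_le_of_le_one_right (Real.exp_pos _).le (hind1 r)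
  have hchange : A.pullProb ω (M + spike i j ε) i j t
      = ∫ r, Real.exp (ℓ r) * ind r ∂(gaussLaw T M) := by
    have hg : Measurable fun η : Fin t → Feedback N =>
        ENNReal.ofReal (if (A.act t ω η).assign i = j then 1 else 0) :=
      ((Measurable.of_discrete (f := fun a : Action N K C =>
        if a.assign i = j then (1 : ℝ) else 0)).comp
          ((A.measurable_act t).comp measurable_prodMk_left)).ennreal_ofReal
    have h := hcm _ hg
    unfold Algorithm.pullProb
    rw [integral_eq_lintegral_of_nonneg_ae (Filter.Eventually.of_forall hind0)
        hindm.aestronglyMeasurable,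
      integral_eq_lintegral_of_nonneg_ae
        (Filter.Eventually.of_forall fun r => mul_nonneg (Real.exp_pos _).le (hind0 r))
        hprod.aestronglyMeasurable]
    simp_rw [ENNReal.ofReal_mul (Real.exp_pos _).le]
    exact congrArg ENNReal.toReal h
  have hℓi := A.integrable_pathLogLR ω M V t
  have hdiff : ∫ r, Real.exp (ℓ r) * ind r ∂(gaussLaw T M) - A.pullProb ω M i j t ≤
      ∫ r, ((Real.exp (ℓ r) - 1 - ℓ r) / c + c / 2 * (Real.exp (ℓ r) + 1)) ∂(gaussLaw T M) := by
    unfold Algorithm.pullProb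
    rw [← integral_sub hprod (A.integrable_pull ω M i j t)]
    refine integral_mono (hprod.sub (A.integrable_pull ω M i j t))
      ((((hexp.sub (integrable_const _)).sub hℓi).div_const _).add
        ((hexp.add (integrable_const _)).const_mul _)) fun r => ?_
    refine le_trans ?_ (abs_exp_sub_one_le (ℓ r) hc)
    calc Real.exp (ℓ r) * ind r - ind r = (Real.exp (ℓ r) - 1) * ind r := by ring
      _ ≤ |Real.exp (ℓ r) - 1| * ind r := mul_le_mul_of_nonneg_right (le_abs_self _) (hind0 r)
      _ ≤ |Real.exp (ℓ r) - 1| := mul_le_of_le_one_right (abs_nonneg _) (hind1 r)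
  have hval : ∫ r, ((Real.exp (ℓ r) - 1 - ℓ r) / c + c / 2 * (Real.exp (ℓ r) + 1))
      ∂(gaussLaw T M) = (-∫ r, ℓ r ∂(gaussLaw T M)) / c + c := by
    have e1 : Integrable (fun r => Real.exp (ℓ r) - 1) (gaussLaw T M) :=
      hexp.sub (integrable_const _)
    have e2 : Integrable (fun r => Real.exp (ℓ r) - 1 - ℓ r) (gaussLaw T M) := e1.sub hℓi
    have e3 : Integrable (fun r => Real.exp (ℓ r) + 1) (gaussLaw T M) :=
      hexp.add (integrable_const _)
    rw [integral_add (e2.div_const _) (e3.const_mul _), integral_div, integral_const_mul,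
      integral_sub e1 hℓi, integral_sub hexp (integrable_const _),
      integral_add hexp (integrable_const _), hexp1]
    simp only [integral_const, probReal_univ, smul_eq_mul]
    ring
  have hkl := A.neg_integral_pathLogLR_le ω M V i j ε hV t
  have hkl' : (-∫ r, ℓ r ∂(gaussLaw T M)) / c ≤
      ε ^ 2 / (2 * C) * (∑ s, A.pullProb ω M i j s) / c := by gcongr
  linarith

/-! ### Gaussian instances and their regret -/

lemma hasSubgaussianMGF_gaussianReal_centered (m : ℝ) :
    HasSubgaussianMGF (fun x : ℝ => x - ∫ y, y ∂(gaussianReal m 1)) 1 (gaussianReal m 1) := by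
  rw [integral_id_gaussianReal]
  refine ⟨fun t => ?_, fun t => ?_⟩
  · have h : (fun x : ℝ => Real.exp (t * (x - m))) =
        fun x => Real.exp (-(t * m)) * Real.exp (t * x) := by
      ext x
      rw [← Real.exp_add]
      congr 1
      ring
    rw [h]
    exact (integrable_exp_mul_gaussianReal t).const_mul _
  · rw [mgf_gaussianReal (gaussianReal_map_sub_const m)]
    simp

/-- The instance with normal rewards of variance `1` and means `M`. -/
noncomputable def gaussInstance (M : Fin N → Fin K → ℝ) (hM : ∀ i j, M i j ∈ Set.Icc (0 : ℝ) 1) :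
    Instance N K where
  D i j := gaussianReal (M i j) 1
  isProb _ _ := inferInstance
  subgaussian _ _ := hasSubgaussianMGF_gaussianReal_centered _
  mean_mem i j := by rw [integral_id_gaussianReal]; exact hM i j

/-- The mean matrix in which user `i` has mean reward `ε` on arm `a i` and `0` on all others. -/
def armMeans (a : Fin N → Fin K) (ε : ℝ) : Fin N → Fin K → ℝ :=
  fun i j => if j = a i then ε else 0

lemma armMeans_mem_Icc (a : Fin N → Fin K) {ε : ℝ} (h0 : 0 ≤ ε) (h1 : ε ≤ 1) (i : Fin N)
    (j : Fin K) : armMeans a ε i j ∈ Set.Icc (0 : ℝ) 1 := by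
  unfold armMeans
  split_ifs
  · exact ⟨h0, h1⟩
  · simp

lemma Algorithm.measurable_pullProb (A : Algorithm.{u} N K C T) (M : Fin N → Fin K → ℝ)
    (i : Fin N) (j : Fin K) (t : Fin T) : Measurable fun ω => A.pullProb ω M i j t :=
  ((A.measurable_pull i j t).stronglyMeasurable.integral_prod_right').measurable

lemma Algorithm.integrable_pullProb (A : Algorithm.{u} N K C T) (M : Fin N → Fin K → ℝ)
    (i : Fin N) (j : Fin K) (t : Fin T) :
    Integrable (fun ω => A.pullProb ω M i j t) A.seedLaw := by
  refine Integrable.of_bound (A.measurable_pullProb M i j t).aestronglyMeasurable 1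
    (Filter.Eventually.of_forall fun ω => ?_)
  rw [Real.norm_eq_abs, abs_of_nonneg (A.pullProb_nonneg ω M i j t)]
  exact A.pullProb_le_one ω M i j t

lemma Algorithm.integral_totalReward (A : Algorithm.{u} N K C T) (a : Fin N → Fin K) (ε : ℝ) :
    ∫ p, A.totalReward p.1 p.2 ∂(A.seedLaw.prod (gaussLaw T (armMeans a ε))) =
      ∫ ω, ∑ t, ∑ i, ε * A.pullProb ω (armMeans a ε) i (a i) t ∂A.seedLaw := by
  set M := armMeans a ε
  let F : Action N K C → (Fin N → Fin K → ℝ) → ℝ := fun b x => ∑ i, x i (b.assign i)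
  have hFm : ∀ b, Measurable (F b) := fun b => by fun_prop
  have hF : ∀ b, Integrable (F b) (roundLaw M) := fun b =>
    integrable_finsetSum _ fun i _ => integrable_eval_roundLaw M i _
  have hFint : ∀ b, ∫ x, F b x ∂(roundLaw M) = ∑ i, ε * if b.assign i = a i then 1 else 0 := by
    intro b
    simp only [F]
    rw [integral_finsetSum _ fun i _ => integrable_eval_roundLaw M i _]
    refine Finset.sum_congr rfl fun i _ => ?_
    rw [integral_eval_roundLaw]
    simp [M, armMeans]
  have hi : ∀ t, Integrable (fun p : A.Seed × (Fin T → Fin N → Fin K → ℝ) =>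
      F (A.action p.1 p.2 t) (p.2 t)) (A.seedLaw.prod (gaussLaw T M)) := fun t =>
    integrable_action_reward (A.measurable_action t)
      ((measurePreserving_eval_gaussLaw M t).comp measurePreserving_snd) hFm hF
  have htot : ∀ p : A.Seed × (Fin T → Fin N → Fin K → ℝ), A.totalReward p.1 p.2
      = ∑ t, F (A.action p.1 p.2 t) (p.2 t) := fun p => rfl
  simp_rw [htot]
  rw [integral_finsetSum _ fun t _ => hi t, integral_finsetSum _ fun t _ =>
    integrable_finsetSum _ fun i _ => (A.integrable_pullProb M i (a i) t).const_mul ε]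
  refine Finset.sum_congr rfl fun t _ => ?_
  rw [integral_prod _ (hi t)]
  refine integral_congr_ae (Filter.Eventually.of_forall fun ω => ?_)
  dsimp only
  rw [A.integral_action_reward ω M t hFm hF]
  simp_rw [hFint]
  rw [integral_finsetSum _ fun i _ => (A.integrable_pull ω M i (a i) t).const_mul ε]
  exact Finset.sum_congr rfl fun i _ => integral_const_mul _ _

/-- Every round in which a user does not play its best arm costs `ε`. -/
lemma Algorithm.expectedRegret_gaussInstance (A : Algorithm.{u} N K C T) (a : Fin N → Fin K)
    {ε : ℝ} (h0 : 0 ≤ ε) (hM : ∀ i j, armMeans a ε i j ∈ Set.Icc (0 : ℝ) 1) :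
    A.expectedRegret (gaussInstance (armMeans a ε) hM) =
      ∫ ω, ε * ∑ i, ∑ t, (1 - A.pullProb ω (armMeans a ε) i (a i) t) ∂A.seedLaw := by
  have hmean : ∀ i j, (gaussInstance (armMeans a ε) hM).mean i j = armMeans a ε i j := fun i j =>
    integral_id_gaussianReal
  have hsup : ∀ i, (⨆ j, (gaussInstance (armMeans a ε) hM).mean i j) = ε := by
    intro i
    simp_rw [hmean]
    have hle : ∀ j, armMeans a ε i j ≤ ε := fun j => by
      simp only [armMeans]
      split_ifs
      exacts [le_rfl, h0]
    have : Nonempty (Fin K) := ⟨a i⟩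
    refine le_antisymm (ciSup_le hle) ?_
    refine le_trans (by simp [armMeans]) (le_ciSup ⟨ε, ?_⟩ (a i))
    rintro _ ⟨j, rfl⟩
    exact hle j
  have hS : Integrable (fun ω => ∑ t, ∑ i, ε * A.pullProb ω (armMeans a ε) i (a i) t) A.seedLaw :=
    integrable_finsetSum _ fun t _ => integrable_finsetSum _ fun i _ =>
      (A.integrable_pullProb (armMeans a ε) i (a i) t).const_mul ε
  unfold Algorithm.expectedRegret
  simp_rw [hsup]
  rw [show (gaussInstance (armMeans a ε) hM).rewardLaw T = gaussLaw T (armMeans a ε) from rfl,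
    A.integral_totalReward a ε]
  have hpt : ∀ ω, ε * ∑ i, ∑ t, (1 - A.pullProb ω (armMeans a ε) i (a i) t)
      = (T : ℝ) * ∑ _i : Fin N, ε - ∑ t, ∑ i, ε * A.pullProb ω (armMeans a ε) i (a i) t := by
    intro ω
    rw [Finset.sum_comm (s := (Finset.univ : Finset (Fin T)))]
    simp only [Finset.sum_sub_distrib, Finset.sum_const, Finset.card_univ, Fintype.card_fin,
      nsmul_eq_mul, mul_one, mul_sub, Finset.mul_sum]
    ring
  simp_rw [hpt]
  rw [integral_sub (integrable_const _) hS]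
  simp

/-! ### Averaging over the hidden arms -/

lemma sum_sum_update {ι κ : Type*} [Fintype ι] [DecidableEq ι] [Fintype κ] (i : ι)
    (f : (ι → κ) → ℝ) :
    ∑ b : ι → κ, ∑ j, f (Function.update b i j) = Fintype.card κ * ∑ b, f b := by
  classical
  -- exchanging the entry at `i` with the second component is an involution
  let φ : (ι → κ) × κ → (ι → κ) × κ := fun p => (Function.update p.1 i p.2, p.1 i)
  have hφ : Function.Involutive φ := fun p => by simp [φ]
  have h := Equiv.sum_comp hφ.toPerm (fun p : (ι → κ) × κ => f p.1)
  rw [Fintype.sum_prod_type, Fintype.sum_prod_type] at h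
  simpa [φ, Finset.mul_sum] using h

/-- The mean matrix in which all arms of user `i` have mean `0`. -/
def eraseUser (M : Fin N → Fin K → ℝ) (i : Fin N) : Fin N → Fin K → ℝ :=
  fun k l => if k = i then 0 else M k l

/-- A user whose best arm is uniformly distributed over the `K` arms plays it at most in a fraction
`11 / 16` of all rounds. -/
lemma Algorithm.sum_pullProb_spike_le (A : Algorithm.{u} N K C T) (hK : 2 ≤ K) (hC : 1 ≤ C)
    (ω : A.Seed) (M : Fin N → Fin K → ℝ) (i : Fin N) {ε : ℝ} (hε : 64 * T * ε ^ 2 = C * K) :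
    ∑ j, ∑ t, A.pullProb ω (M + spike i j ε) i j t ≤ 11 / 16 * (K * T) := by
  have hCpos : (0 : ℝ) < C := by exact_mod_cast hC
  have hK' : (2 : ℝ) ≤ K := by exact_mod_cast hK
  have hsum : ∑ j, ∑ t, A.pullProb ω M i j t = T := by
    rw [Finset.sum_comm]
    simp [A.sum_pullProb]
  have h : ∀ j, ∑ t, A.pullProb ω (M + spike i j ε) i j t ≤ ∑ t, A.pullProb ω M i j t +
      T * (1 / 8) + T * (ε ^ 2 / (2 * C) * (∑ s, A.pullProb ω M i j s) / (1 / 8)) := by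
    intro j
    refine (Finset.sum_le_sum fun t _ =>
      A.pullProb_add_spike_le hC ω M i j ε (by norm_num : (0 : ℝ) < 1 / 8) t).trans (le_of_eq ?_)
    simp [Finset.sum_add_distrib]
  refine (Finset.sum_le_sum fun j _ => h j).trans ?_
  have h1 : ∑ j, (T : ℝ) * (ε ^ 2 / (2 * C) * (∑ s, A.pullProb ω M i j s) / (1 / 8)) =
      T * (ε ^ 2 / (2 * C) * T / (1 / 8)) := by
    rw [← Finset.mul_sum, ← Finset.sum_div, ← Finset.mul_sum, hsum]
  rw [Finset.sum_add_distrib, Finset.sum_add_distrib, hsum, h1]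
  simp only [Finset.sum_const, Finset.card_univ, Fintype.card_fin, nsmul_eq_mul]
  have h2 : (T : ℝ) * (ε ^ 2 / (2 * C) * T / (1 / 8)) = K * T / 16 := by
    have : (T : ℝ) * (ε ^ 2 / (2 * C) * T / (1 / 8)) = (64 * T * ε ^ 2) * T / (16 * C) := by
      field_simp
      ring
    rw [this, hε]
    field_simp
  rw [h2]
  nlinarith [(Nat.cast_nonneg T : (0 : ℝ) ≤ T)]

/-- The best arms of the users: the first `K * U` users cycle through the arms, which guarantees
the cluster property, and every other user `i` has the hidden arm `b i`. -/
def bestArm (hK : 0 < K) (U : ℕ) (b : Fin N → Fin K) (i : Fin N) : Fin K :=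
  if (i : ℕ) < K * U then ⟨i % K, Nat.mod_lt _ hK⟩ else b i

lemma userCluster_gaussInstance {U : ℕ} (hK : 0 < K) (hN : K * U ≤ N) (b : Fin N → Fin K) {ε : ℝ}
    (hε : 0 < ε) (hM : ∀ i j, armMeans (bestArm hK U b) ε i j ∈ Set.Icc (0 : ℝ) 1) :
    (gaussInstance (armMeans (bestArm hK U b) ε) hM).UserCluster U := by
  intro j
  have hlt : ∀ q : Fin U, (q : ℕ) * K + j < K * U := fun q => by
    have h1 : ((q : ℕ) + 1) * K ≤ U * K := Nat.mul_le_mul_right _ q.isLt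
    have h2 := j.isLt
    rw [mul_comm K U]
    linarith [add_mul (q : ℕ) 1 K]
  let f : Fin U → Fin N := fun q => ⟨q * K + j, (hlt q).trans_le hN⟩
  have hf : Function.Injective f := fun q q' h => by
    have h1 : (q : ℕ) * K + j = q' * K + j := congrArg Fin.val h
    exact Fin.ext (Nat.eq_of_mul_eq_mul_right hK (Nat.add_right_cancel h1))
  have hsub : Set.range f ⊆
      {i | (gaussInstance (armMeans (bestArm hK U b) ε) hM).IsOptimalArm i j} := by
    rintro _ ⟨q, rfl⟩ j' hj'
    have hbest : bestArm hK U b (f q) = j := by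
      unfold bestArm
      rw [if_pos (hlt q)]
      ext
      simp [f, Nat.mod_eq_of_lt j.isLt]
    have hmean : ∀ l, (gaussInstance (armMeans (bestArm hK U b) ε) hM).mean (f q) l
        = armMeans (bestArm hK U b) ε (f q) l := fun l => integral_id_gaussianReal
    rw [hmean, hmean]
    simpa [armMeans, hbest, hj'] using hε
  calc U = (Set.range f).ncard := by
        rw [← Set.image_univ, Set.ncard_image_of_injective _ hf, Set.ncard_univ, Nat.card_fin]
    _ ≤ _ := Set.ncard_le_ncard hsub (Set.toFinite _)

lemma Algorithm.sum_pullProb_bestArm_le (A : Algorithm.{u} N K C T) (hK : 2 ≤ K) (hC : 1 ≤ C)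
    (ω : A.Seed) (U : ℕ) {i : Fin N} (hi : K * U ≤ i) {ε : ℝ} (hε : 64 * T * ε ^ 2 = C * K) :
    ∑ b : Fin N → Fin K, ∑ t, A.pullProb ω (armMeans (bestArm (by omega) U b) ε) i
      (bestArm (by omega) U b i) t ≤ 11 / 16 * T * (Fintype.card (Fin N → Fin K)) := by
  have hK0 : 0 < K := by omega
  have hK' : (0 : ℝ) < K := by exact_mod_cast hK0
  have hbest : ∀ b : Fin N → Fin K, bestArm hK0 U b i = b i := fun b => if_neg (by omega)
  have hup : ∀ (b : Fin N → Fin K) (j : Fin K),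
      armMeans (bestArm hK0 U (Function.update b i j)) ε =
        eraseUser (armMeans (bestArm hK0 U b) ε) i + spike i j ε := by
    intro b j
    ext k l
    by_cases hk : k = i
    · subst hk
      simp [armMeans, eraseUser, spike, hbest]
    · have hb : bestArm hK0 U (Function.update b i j) k = bestArm hK0 U b k := by
        unfold bestArm
        rw [Function.update_of_ne hk]
      simp [armMeans, eraseUser, spike, hk, hb]
  have h := sum_sum_update i fun b : Fin N → Fin K =>
    ∑ t, A.pullProb ω (armMeans (bestArm hK0 U b) ε) i (bestArm hK0 U b i) t
  simp only [hup, hbest, Function.update_self, Fintype.card_fin] at h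
  have hle := Finset.sum_le_sum fun (b : Fin N → Fin K) (_ : b ∈ Finset.univ) =>
    A.sum_pullProb_spike_le hK hC ω (eraseUser (armMeans (bestArm hK0 U b) ε) i) i hε
  rw [h, Finset.sum_const, Finset.card_univ, nsmul_eq_mul] at hle
  simp only [hbest]
  refine le_of_mul_le_mul_left (hle.trans (le_of_eq ?_)) hK'
  ring

/-- On average over the hidden arms, for a fixed seed, the users miss their best arms in a constant
fraction of all rounds: at least `N / 2` users have a hidden arm, and each of them misses it in
`5 / 16` of the rounds. -/
lemma Algorithm.le_sum_missed (A : Algorithm.{u} N K C T) (hK : 2 ≤ K) (hC : 1 ≤ C)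
    (ω : A.Seed) {U : ℕ} (hN : 2 * K * U ≤ N) {ε : ℝ} (hε : 64 * T * ε ^ 2 = C * K) :
    5 / 32 * N * T * (Fintype.card (Fin N → Fin K)) ≤
      ∑ b : Fin N → Fin K, ∑ i, ∑ t, (1 - A.pullProb ω (armMeans (bestArm (by omega) U b) ε) i
        (bestArm (by omega) U b i) t) := by
  have hK0 : 0 < K := by omega
  set S := Finset.univ.filter fun i : Fin N => K * U ≤ (i : ℕ) with hS
  have hScard : (N : ℝ) / 2 ≤ S.card := by
    have h1 : (Finset.univ.filter fun i : Fin N => (i : ℕ) < K * U).card ≤ K * U := by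
      simpa using Finset.card_le_card_of_injOn (t := Finset.range (K * U))
        (fun i : Fin N => (i : ℕ)) (fun i hi => by simpa using hi)
        (fun i _ k _ h => Fin.ext h)
    have h2 := Finset.card_filter_add_card_filter_not (s := (Finset.univ : Finset (Fin N)))
      (fun i : Fin N => (i : ℕ) < K * U)
    have hneg : Finset.univ.filter (fun i : Fin N => ¬ (i : ℕ) < K * U) = S := by
      ext i
      simp [hS]
    rw [hneg, Finset.card_univ, Fintype.card_fin] at h2
    have h3 : N ≤ 2 * S.card := by
      rw [mul_assoc] at hN
      omega
    have h4 : (N : ℝ) ≤ 2 * S.card := by exact_mod_cast h3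
    linarith
  set B : ℝ := ((Fintype.card (Fin N → Fin K) : ℕ) : ℝ) with hB
  have hB0 : 0 ≤ B := Nat.cast_nonneg _
  have hT0 : (0 : ℝ) ≤ T := Nat.cast_nonneg _
  rw [Finset.sum_comm]
  calc 5 / 32 * N * T * B = (N : ℝ) / 2 * (5 / 16 * T * B) := by ring
    _ ≤ S.card * (5 / 16 * T * B) := by gcongr
    _ = ∑ i ∈ S, (5 / 16 * T * B) := by rw [Finset.sum_const, nsmul_eq_mul]
    _ ≤ ∑ i ∈ S, ∑ b : Fin N → Fin K, ∑ t,
        (1 - A.pullProb ω (armMeans (bestArm hK0 U b) ε) i (bestArm hK0 U b i) t) := by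
      refine Finset.sum_le_sum fun i hi => ?_
      have h := A.sum_pullProb_bestArm_le hK hC ω U (Finset.mem_filter.1 hi).2 hε
      simp only [Finset.sum_sub_distrib, Finset.sum_const, Finset.card_univ, Fintype.card_fin,
        nsmul_eq_mul, mul_one]
      simp only [← hB] at h ⊢
      linarith
    _ ≤ _ := Finset.sum_le_sum_of_subset_of_nonneg (Finset.subset_univ _) fun i _ _ =>
      Finset.sum_nonneg fun b _ => Finset.sum_nonneg fun t _ =>
        sub_nonneg.2 (A.pullProb_le_one ω _ i _ t)

end AnonymousBandits

theorem theorem3 :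
    ∃ c : ℝ, 0 < c ∧ ∀ N K C U T : ℕ, 2 ≤ K → 1 ≤ C → K * (C + 1) ≤ U → 2 * K * U ≤ N → C * K ≤ T →
      -- every algorithm has large expected regret on some instance with the cluster property
      (∀ A : AnonymousBandits.Algorithm.{u} N K C T,
        ∃ I : AnonymousBandits.Instance N K, I.UserCluster U ∧
          c * (N : ℝ) * Real.sqrt ((C : ℝ) * (K : ℝ) * (T : ℝ)) ≤ A.expectedRegret I) ∧
      -- moreover, one distribution of instances (uniform on a finite list) is hard for all algorithms
      (∃ m : ℕ, 0 < m ∧ ∃ I : Fin m → AnonymousBandits.Instance N K,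
        (∀ a, (I a).UserCluster U) ∧
          ∀ A : AnonymousBandits.Algorithm.{u} N K C T,
            c * (N : ℝ) * Real.sqrt ((C : ℝ) * (K : ℝ) * (T : ℝ)) ≤
              (∑ a : Fin m, A.expectedRegret (I a)) / (m : ℝ)) := by
  refine ⟨1 / 64, by norm_num, fun N K C U T hK hC _ hN hT => ?_⟩
  -- the second claim implies the first, since some instance is at least as hard as the average
  suffices h : ∃ m : ℕ, 0 < m ∧ ∃ I : Fin m → AnonymousBandits.Instance N K,
      (∀ a, (I a).UserCluster U) ∧ ∀ A : AnonymousBandits.Algorithm.{u} N K C T,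
        1 / 64 * (N : ℝ) * Real.sqrt ((C : ℝ) * (K : ℝ) * (T : ℝ)) ≤
          (∑ a : Fin m, A.expectedRegret (I a)) / (m : ℝ) by
    refine ⟨fun A => ?_, h⟩
    obtain ⟨m, hm, I, hI, hA⟩ := h
    have hm' : (0 : ℝ) < m := by exact_mod_cast hm
    have : Nonempty (Fin m) := ⟨⟨0, hm⟩⟩
    have hsum := (le_div_iff₀ hm').1 (hA A)
    obtain ⟨a, -, ha⟩ := Finset.exists_le_of_sum_le
      (f := fun _ : Fin m => 1 / 64 * (N : ℝ) * Real.sqrt ((C : ℝ) * (K : ℝ) * (T : ℝ)))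
      (g := fun a => A.expectedRegret (I a)) Finset.univ_nonempty
      (by simpa [mul_comm] using hsum)
    exact ⟨I a, hI a, ha⟩
  have hK0 : 0 < K := by omega
  have hCpos : (0 : ℝ) < C := by exact_mod_cast hC
  have hKpos : (0 : ℝ) < K := by exact_mod_cast hK0
  have hTpos : (0 : ℝ) < T := by exact_mod_cast (Nat.mul_pos hC hK0).trans_le hT
  have hTle : (C : ℝ) * K ≤ T := by exact_mod_cast hT
  -- the gap `√(C K / T) / 8` balances its cost per round against the information it reveals
  set ε : ℝ := Real.sqrt (C * K * T) / (8 * T) with hεdef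
  have hε0 : 0 < ε := by positivity
  have hεsq : 64 * T * ε ^ 2 = C * K := by
    rw [hεdef, div_pow, Real.sq_sqrt (by positivity)]
    field_simp
    norm_num
  have hε1 : ε ≤ 1 := by
    have : ε ^ 2 ≤ 1 := by nlinarith
    nlinarith
  have hM : ∀ b : Fin N → Fin K, ∀ i j,
      AnonymousBandits.armMeans (AnonymousBandits.bestArm hK0 U b) ε i j ∈ Set.Icc (0 : ℝ) 1 :=
    fun b => AnonymousBandits.armMeans_mem_Icc _ hε0.le hε1
  have : Nonempty (Fin K) := ⟨⟨0, hK0⟩⟩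
  let e := Fintype.equivFin (Fin N → Fin K)
  have hcard : 0 < Fintype.card (Fin N → Fin K) := Fintype.card_pos
  refine ⟨Fintype.card (Fin N → Fin K), hcard,
    fun a => AnonymousBandits.gaussInstance _ (hM (e.symm a)), fun a =>
      AnonymousBandits.userCluster_gaussInstance hK0 (by nlinarith) _ hε0 _, fun A => ?_⟩
  have hcard' : (0 : ℝ) < (Fintype.card (Fin N → Fin K) : ℝ) := by exact_mod_cast hcard
  rw [le_div_iff₀ hcard', Equiv.sum_comp e.symm fun b =>
    A.expectedRegret (AnonymousBandits.gaussInstance _ (hM b))]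
  simp_rw [A.expectedRegret_gaussInstance _ hε0.le]
  have hint : ∀ b : Fin N → Fin K, Integrable (fun ω => ε * ∑ i, ∑ t, (1 - A.pullProb ω
      (AnonymousBandits.armMeans (AnonymousBandits.bestArm hK0 U b) ε) i
        (AnonymousBandits.bestArm hK0 U b i) t)) A.seedLaw := fun b =>
    (integrable_finsetSum _ fun i _ => integrable_finsetSum _ fun t _ =>
      (integrable_const _).sub (A.integrable_pullProb _ _ _ _)).const_mul _
  rw [← integral_finsetSum _ fun b _ => hint b]
  have hlow := integral_mono (μ := A.seedLaw) (integrable_const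
    (ε * (5 / 32 * N * T * (Fintype.card (Fin N → Fin K)))))
    (integrable_finsetSum _ fun b (_ : b ∈ Finset.univ) => hint b) fun ω => by
      dsimp only
      rw [← Finset.mul_sum]
      exact mul_le_mul_of_nonneg_left (A.le_sum_missed hK hC ω hN hεsq) hε0.le
  refine le_trans ?_ hlow
  rw [integral_const, probReal_univ, one_smul]
  have hεT : ε * T = Real.sqrt (C * K * T) / 8 := by
    rw [hεdef]
    field_simp
  have hpos : 0 ≤ (N : ℝ) * Real.sqrt (C * K * T) * (Fintype.card (Fin N → Fin K)) := by positivity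
  calc 1 / 64 * (N : ℝ) * Real.sqrt (C * K * T) * (Fintype.card (Fin N → Fin K))
      ≤ 5 / 32 * N * (Real.sqrt (C * K * T) / 8) * (Fintype.card (Fin N → Fin K)) := by linarith
    _ = ε * (5 / 32 * N * T * (Fintype.card (Fin N → Fin K))) := by rw [← hεT]; ring
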